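/- Let $d\ge 4$, let $\mathbb{S}^{d-1}$ be the unit sphere of $\mathbb{R}^d$ with surface measure $d\sigma$, and consider real-valued functions. For $n\ge 0$ let $\mathcal{H}_n^d\subset L^2(\mathbb{S}^{d-1})$ be the space of spherical harmonics of degree $n$ (restrictions to the sphere of homogeneous harmonic polynomials of degree $n$ in $d$ variables), and let $\operatorname{proj}_n$ be the orthogonal projection of $L^2(\mathbb{S}^{d-1})$ onto $\mathcal{H}_n^d$. For $f\in L^2(\mathbb{S}^{d-1})$, $(-\Delta_0)^{1/2}f$ is defined by $\operatorname{proj}_0[(-\Delta_0)^{1/2}f]=0$ and $\operatorname{proj}_n[(-\Delta_0)^{1/2}f]=(n(n+d-2))^{1/2}\operatorname{proj}_n f$ for $n\ge1$; let $W_2^1(\mathbb{S}^{d-1})$ be the set of all $f\in L^2(\mathbb{S}^{d-1})$ with $(-\Delta_0)^{1/2}f\in L^2(\mathbb{S}^{d-1})$. Theorem. For every $d\ge 4$ there is a constant $c_d>0$, depending only on $d$, such that for every $f\in W_2^1(\mathbb{S}^{d-1})$ with $\int_{\mathbb{S}^{d-1}} f\,d\sigma=0$, $$\int_{\mathbb{S}^{d-1}}|f(x)|^2\,d\sigma(x)\le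 c_d\min_{e\in\mathbb{S}^{d-1}}\int_{\mathbb{S}^{d-1}}(1-\langle x,e\rangle)\,\bigl|(-\Delta_0)^{1/2}f(x)\bigr|^2\,d\sigma(x),$$ where the minimum over $e$ is attained. For $d=4$ one can take $c_4=8$. -/

import Mathlib

open MeasureTheory
open scoped ENNReal

noncomputable section

namespace HardyRellich

/-- The unit sphere `S^{d-1}` of the Euclidean space `ℝ^d`. -/
abbrev Sph (d : ℕ) : Type := Metric.sphere (0 : EuclideanSpace ℝ (Fin d)) 1

/-- The (non-normalized) surface measure `σ` on `S^{d-1}`, induced by Lebesgue measure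
through polar coordinates. -/
abbrev surf (d : ℕ) : Measure (Sph d) :=
  (volume : Measure (EuclideanSpace ℝ (Fin d))).toSphere

/-- The real Hilbert space `L²(S^{d-1})`. -/
abbrev L2 (d : ℕ) : Type := Lp ℝ 2 (surf d)

/-- The `i`-th coordinate function on the sphere. -/
def coord (d : ℕ) (i : Fin d) : C(Sph d, ℝ) where
  toFun x := (x : EuclideanSpace ℝ (Fin d)) i
  continuous_toFun := by fun_prop

/-- Restriction of a real polynomial in `d` variables to the sphere. -/
def restrictPoly (d : ℕ) : MvPolynomial (Fin d) ℝ →ₐ[ℝ] C(Sph d, ℝ) :=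
  MvPolynomial.aeval (coord d)

theorem restrictPoly_apply (d : ℕ) (p : MvPolynomial (Fin d) ℝ) (x : Sph d) :
    restrictPoly d p x
      = MvPolynomial.eval (fun i => (x : EuclideanSpace ℝ (Fin d)) i) p := by
  induction p using MvPolynomial.induction_on with
  | C a => simp [restrictPoly]
  | add p q hp hq => simp [hp, hq]
  | mul_X p i hp => rw [map_mul, map_mul, ContinuousMap.mul_apply, hp]; simp [restrictPoly, coord]

/-- The Laplacian `∑ i, ∂²/∂xᵢ²` on polynomials in `d` variables. -/
def polyLaplacian (d : ℕ) : MvPolynomial (Fin d) ℝ →ₗ[ℝ] MvPolynomial (Fin d) ℝ :=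
  ∑ i : Fin d, (MvPolynomial.pderiv i).toLinearMap ∘ₗ (MvPolynomial.pderiv i).toLinearMap

/-- Homogeneous harmonic polynomials of degree `n` in `d` variables. -/
def harmonicPoly (d n : ℕ) : Submodule ℝ (MvPolynomial (Fin d) ℝ) :=
  MvPolynomial.homogeneousSubmodule (Fin d) ℝ n ⊓ LinearMap.ker (polyLaplacian d)

/-- The space of spherical harmonics of degree `n` (restrictions to the sphere of homogeneous
harmonic polynomials of degree `n`), as a subspace of `L²(S^{d-1})`. -/
def sphericalHarmonics (d n : ℕ) : Submodule ℝ (L2 d) :=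
  (harmonicPoly d n).map
    ((ContinuousMap.toLp (E := ℝ) 2 (surf d) ℝ).toLinearMap ∘ₗ (restrictPoly d).toLinearMap)

instance finiteDimensional_harmonicPoly (d n : ℕ) :
    FiniteDimensional ℝ (harmonicPoly d n) := by
  have h : FiniteDimensional ℝ (MvPolynomial.homogeneousSubmodule (Fin d) ℝ n) :=
    Module.Finite.iff_fg.mpr (MvPolynomial.homogeneousSubmodule_fg (Fin d) ℝ n)
  exact Submodule.finiteDimensional_of_le
    (inf_le_left : harmonicPoly d n ≤ MvPolynomial.homogeneousSubmodule (Fin d) ℝ n)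

instance finiteDimensional_sphericalHarmonics (d n : ℕ) :
    FiniteDimensional ℝ (sphericalHarmonics d n) := by
  unfold sphericalHarmonics
  infer_instance

/-- The orthogonal projection `proj_n` of `L²(S^{d-1})` onto the spherical harmonics of
degree `n`. -/
def proj (d n : ℕ) : L2 d →L[ℝ] L2 d := (sphericalHarmonics d n).starProjection

/-- `IsFracLaplaceBeltrami d r f g` says that `g = (-Δ₀)^r f` in `L²(S^{d-1})`, i.e. that the
spherical harmonic expansion of `g` is obtained from that of `f` by killing the component of
degree `0` and multiplying the component of degree `n ≥ 1` by `(n (n + d - 2))^r`. -/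
def IsFracLaplaceBeltrami (d : ℕ) (r : ℝ) (f g : L2 d) : Prop :=
  proj d 0 g = 0 ∧
    ∀ n : ℕ, 1 ≤ n → proj d n g = ((n : ℝ) * ((n : ℝ) + (d : ℝ) - 2)) ^ r • proj d n f

/-- The Sobolev space `W_2^α(S^{d-1})`: all `f ∈ L²` for which `(-Δ₀)^{α/2} f` belongs
to `L²`. -/
def sobolevW2 (d : ℕ) (α : ℝ) : Set (L2 d) :=
  {f | ∃ g : L2 d, IsFracLaplaceBeltrami d (α / 2) f g}

end HardyRellich

end

noncomputable section

namespace HardyRellich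

open MvPolynomial

/-! Write `g = (-Δ₀)^{1/2} f` and let `a n` be the norm of its degree `n` component. Multiplication
by `⟨x, e⟩` couples only neighbouring degrees, through a raising operator and its adjoint, the
lowering operator. For `d ≥ 4` both have norm at most `1/2` (`norm_raise_le`), so the integral of
`⟨x, e⟩ |g|²` is at most `∑ a n * a (n + 1)`. The weighted integral is therefore at least `∑ (a n)²
- ∑ a n * a (n + 1)`, and a discrete Hardy inequality (`sum_div_sq_le`) bounds this below by `1/8 *
∑ (a n)² / n²`. Since `n (n + d - 2) ≥ n²` and `f` has mean zero, the last sum dominates `‖f‖²`.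

The bound `1/2` comes from the commutation relation `lower_raise`, which turns a bound for lowering
in degree `n` into one for raising in the same degree; adjointness passes the latter to lowering in
degree `n + 1`. Orthogonality of the degrees is proved with Gaussian integrals, and completeness
with Stone–Weierstrass. -/

/-! ### Differential calculus on polynomials -/

/-- The linear form `x ↦ ⟨x, v⟩` as a polynomial. -/
def linearPoly (d : ℕ) (v : Fin d → ℝ) : MvPolynomial (Fin d) ℝ := ∑ i, v i • X i

/-- The polynomial `|x|²`. -/
def normSqPoly (d : ℕ) : MvPolynomial (Fin d) ℝ := ∑ i, X i * X i

/-- The directional derivative `∂_v` on polynomials. -/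
def dirDeriv (d : ℕ) (v : Fin d → ℝ) :
    Derivation ℝ (MvPolynomial (Fin d) ℝ) (MvPolynomial (Fin d) ℝ) := ∑ i, v i • pderiv i

variable {d : ℕ}

theorem dirDeriv_apply (v : Fin d → ℝ) (p : MvPolynomial (Fin d) ℝ) :
    dirDeriv d v p = ∑ i, v i • pderiv i p := by
  rw [dirDeriv, ← Derivation.coeFnAddMonoidHom_apply, map_sum, Finset.sum_apply]
  simp

theorem polyLaplacian_apply (p : MvPolynomial (Fin d) ℝ) :
    polyLaplacian d p = ∑ i, pderiv i (pderiv i p) := by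
  simp [polyLaplacian]

/-- The commutator of two derivations is a derivation, so it is enough that it kills the variables.
-/
theorem pderiv_comm (i j : Fin d) (p : MvPolynomial (Fin d) ℝ) :
    pderiv i (pderiv j p) = pderiv j (pderiv i p) := by
  let D (i : Fin d) : Derivation ℝ (MvPolynomial (Fin d) ℝ) (MvPolynomial (Fin d) ℝ) := pderiv i
  have h : ⁅D i, D j⁆ = 0 := by
    apply MvPolynomial.derivation_ext
    intro k
    simp [D, Derivation.commutator_apply, pderiv_X, Pi.single_apply, apply_ite]
  have := DFunLike.congr_fun h p
  simpa [D, Derivation.commutator_apply, sub_eq_zero] using this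

theorem pderiv_linearPoly (v : Fin d → ℝ) (i : Fin d) : pderiv i (linearPoly d v) = C (v i) := by
  simp [linearPoly, pderiv_X, Pi.single_apply, smul_eq_C_mul]

theorem pderiv_normSqPoly (i : Fin d) : pderiv i (normSqPoly d) = 2 * X i := by
  simp [normSqPoly, pderiv_X, Pi.single_apply, Finset.sum_add_distrib, two_mul]

theorem dirDeriv_linearPoly (v w : Fin d → ℝ) :
    dirDeriv d v (linearPoly d w) = C (∑ i, v i * w i) := by
  simp [dirDeriv_apply, pderiv_linearPoly, smul_eq_C_mul]

theorem dirDeriv_normSqPoly (v : Fin d → ℝ) :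
    dirDeriv d v (normSqPoly d) = 2 * linearPoly d v := by
  simp [dirDeriv_apply, pderiv_normSqPoly, linearPoly, Finset.mul_sum]

theorem polyLaplacian_dirDeriv (v : Fin d → ℝ) (p : MvPolynomial (Fin d) ℝ) :
    polyLaplacian d (dirDeriv d v p) = dirDeriv d v (polyLaplacian d p) := by
  simp only [polyLaplacian_apply, dirDeriv_apply, map_sum, Derivation.map_smul]
  rw [Finset.sum_comm]
  refine Finset.sum_congr rfl fun i _ => Finset.sum_congr rfl fun j _ => ?_
  rw [pderiv_comm j i (pderiv i p), pderiv_comm j i p]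

theorem polyLaplacian_mul (p q : MvPolynomial (Fin d) ℝ) :
    polyLaplacian d (p * q) =
      polyLaplacian d p * q + 2 * ∑ i, pderiv i p * pderiv i q + p * polyLaplacian d q := by
  simp only [polyLaplacian_apply, Finset.sum_mul, Finset.mul_sum, ← Finset.sum_add_distrib]
  refine Finset.sum_congr rfl fun i _ => ?_
  simp only [pderiv_mul, map_add]
  ring

theorem polyLaplacian_linearPoly_mul (v : Fin d → ℝ) (p : MvPolynomial (Fin d) ℝ) :
    polyLaplacian d (linearPoly d v * p) =
      2 * dirDeriv d v p + linearPoly d v * polyLaplacian d p := by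
  rw [polyLaplacian_mul]
  simp [polyLaplacian_apply (linearPoly d v), pderiv_linearPoly, dirDeriv_apply, smul_eq_C_mul]

theorem polyLaplacian_normSqPoly_mul {n : ℕ} {p : MvPolynomial (Fin d) ℝ}
    (hp : p.IsHomogeneous n) :
    polyLaplacian d (normSqPoly d * p) =
      (2 * d + 4 * n : ℝ) • p + normSqPoly d * polyLaplacian d p := by
  have h1 : polyLaplacian d (normSqPoly d) = C (2 * d : ℝ) := by
    simp only [polyLaplacian_apply, pderiv_normSqPoly, pderiv_mul, pderiv_X_self]
    have : ∀ i : Fin d, pderiv i (2 : MvPolynomial (Fin d) ℝ) = 0 := fun i => by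
      rw [← map_ofNat C 2, pderiv_C]
    simp [this, mul_comm, map_ofNat C 2]
  have h2 : ∑ i, pderiv i (normSqPoly d) * pderiv i p = (2 * n : ℝ) • p := by
    have := hp.sum_X_mul_pderiv
    simp only [pderiv_normSqPoly, mul_assoc, ← Finset.mul_sum, this]
    simp [smul_eq_C_mul, mul_assoc, map_ofNat C 2]
  rw [polyLaplacian_mul, h1, h2]
  simp only [smul_eq_C_mul, map_add, map_mul, map_ofNat, map_natCast]
  ring

theorem mem_harmonicPoly {n : ℕ} {p : MvPolynomial (Fin d) ℝ} :
    p ∈ harmonicPoly d n ↔ p.IsHomogeneous n ∧ polyLaplacian d p = 0 := by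
  simp [harmonicPoly, mem_homogeneousSubmodule]

theorem isHomogeneous_linearPoly (v : Fin d → ℝ) : (linearPoly d v).IsHomogeneous 1 :=
  IsHomogeneous.sum _ _ _ fun i _ => by
    rw [smul_eq_C_mul]; simpa using (isHomogeneous_C (Fin d) (v i)).mul (isHomogeneous_X ℝ i)

theorem isHomogeneous_normSqPoly : (normSqPoly d).IsHomogeneous 2 :=
  IsHomogeneous.sum _ _ _ fun i _ => (isHomogeneous_X ℝ i).mul (isHomogeneous_X ℝ i)

theorem IsHomogeneous.dirDeriv {n : ℕ} {p : MvPolynomial (Fin d) ℝ} (hp : p.IsHomogeneous n)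
    (v : Fin d → ℝ) : (HardyRellich.dirDeriv d v p).IsHomogeneous (n - 1) := by
  rw [dirDeriv_apply]
  refine IsHomogeneous.sum _ _ _ fun i _ => ?_
  rw [smul_eq_C_mul]; simpa using (isHomogeneous_C (Fin d) (v i)).mul (hp.pderiv (i := i))

theorem dirDeriv_mem_harmonicPoly {n : ℕ} {p : MvPolynomial (Fin d) ℝ}
    (hp : p ∈ harmonicPoly d n) (v : Fin d → ℝ) : dirDeriv d v p ∈ harmonicPoly d (n - 1) := by
  rw [mem_harmonicPoly] at hp ⊢
  exact ⟨IsHomogeneous.dirDeriv hp.1 v, by rw [polyLaplacian_dirDeriv, hp.2, map_zero]⟩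

theorem dirDeriv_eq_zero_of_mem_zero {p : MvPolynomial (Fin d) ℝ}
    (hp : p ∈ harmonicPoly d 0) (v : Fin d → ℝ) : dirDeriv d v p = 0 := by
  have h := (mem_harmonicPoly.1 hp).1
  rw [← totalDegree_zero_iff_isHomogeneous, totalDegree_eq_zero_iff_eq_C] at h
  rw [h, ← algebraMap_eq, Derivation.map_algebraMap]

/-! ### Raising and lowering operators -/

/-- The lowering operator: the degree `n - 1` component of multiplication by `⟨x, v⟩` on
spherical harmonics of degree `n`. -/
def lower (d : ℕ) (v : Fin d → ℝ) (n : ℕ) (p : MvPolynomial (Fin d) ℝ) :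
    MvPolynomial (Fin d) ℝ := (2 * n + d - 2 : ℝ)⁻¹ • dirDeriv d v p

/-- The raising operator: the degree `n + 1` component of multiplication by `⟨x, v⟩` on
spherical harmonics of degree `n`. -/
def raise (d : ℕ) (v : Fin d → ℝ) (n : ℕ) (p : MvPolynomial (Fin d) ℝ) :
    MvPolynomial (Fin d) ℝ := linearPoly d v * p - normSqPoly d * lower d v n p

theorem lower_mem_harmonicPoly {n : ℕ} {p : MvPolynomial (Fin d) ℝ}
    (hp : p ∈ harmonicPoly d n) (v : Fin d → ℝ) : lower d v n p ∈ harmonicPoly d (n - 1) :=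
  Submodule.smul_mem _ _ (dirDeriv_mem_harmonicPoly hp v)

theorem lower_eq_zero {p : MvPolynomial (Fin d) ℝ}
    (hp : p ∈ harmonicPoly d 0) (v : Fin d → ℝ) : lower d v 0 p = 0 := by
  rw [lower, dirDeriv_eq_zero_of_mem_zero hp, smul_zero]

/-- The Laplacian of `⟨x, v⟩ p` is `2 ∂_v p`, and that of `|x|² q`, with `q` harmonic of degree `n -
1`, is `(2d + 4(n - 1)) q`. The factor `(2n + d - 2)⁻¹` in `lower` is the one that makes these
cancel. -/
theorem raise_mem_harmonicPoly (hd : 3 ≤ d) {n : ℕ} {p : MvPolynomial (Fin d) ℝ}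
    (hp : p ∈ harmonicPoly d n) (v : Fin d → ℝ) : raise d v n p ∈ harmonicPoly d (n + 1) := by
  have hl := lower_mem_harmonicPoly hp v
  have hd' : (3 : ℝ) ≤ d := by exact_mod_cast hd
  -- Truncated subtraction breaks `2 + (n - 1) = n + 1` at `n = 0`; there the correction term
  -- vanishes anyway.
  rcases Nat.eq_zero_or_pos n with rfl | hn
  · rw [mem_harmonicPoly] at hp ⊢
    rw [raise, lower_eq_zero (mem_harmonicPoly.2 hp), mul_zero, sub_zero]
    refine ⟨by simpa using (isHomogeneous_linearPoly v).mul hp.1, ?_⟩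
    rw [polyLaplacian_linearPoly_mul, hp.2, dirDeriv_eq_zero_of_mem_zero (mem_harmonicPoly.2 hp)]
    simp
  · rw [mem_harmonicPoly] at hp hl ⊢
    refine ⟨?_, ?_⟩
    · refine IsHomogeneous.sub ?_ ?_
      · simpa [add_comm] using (isHomogeneous_linearPoly v).mul hp.1
      · have := isHomogeneous_normSqPoly.mul hl.1
        rwa [show 2 + (n - 1) = n + 1 by omega] at this
    · rw [raise, map_sub, polyLaplacian_linearPoly_mul, polyLaplacian_normSqPoly_mul hl.1, hl.2,
        hp.2, mul_zero, mul_zero, add_zero, add_zero, lower, smul_smul]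
      have : (2 * d + 4 * (n - 1 : ℕ) : ℝ) * (2 * n + d - 2 : ℝ)⁻¹ = 2 := by
        rw [Nat.cast_sub hn]
        have hn' : (1 : ℝ) ≤ n := by exact_mod_cast hn
        field_simp [show (2 * n + d - 2 : ℝ) ≠ 0 by linarith]
        push_cast; ring
      rw [this, smul_eq_C_mul, map_ofNat, sub_self]

/-- Commutation of raising and lowering operators. -/
theorem lower_raise {v : Fin d → ℝ} (hv : ∑ i, v i * v i = 1) (hd : 3 ≤ d) (n : ℕ)
    (p : MvPolynomial (Fin d) ℝ) :
    (2 * n + d : ℝ) • lower d v (n + 1) (raise d v n p) =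
      p + (2 * n + d - 4 : ℝ) • (linearPoly d v * lower d v n p)
        - normSqPoly d * dirDeriv d v (lower d v n p) := by
  have hd' : (3 : ℝ) ≤ d := by exact_mod_cast hd
  have h0 : (0 : ℝ) ≤ n := n.cast_nonneg
  have h1 : dirDeriv d v p = (2 * n + d - 2 : ℝ) • lower d v n p := by
    rw [lower, smul_smul, mul_inv_cancel₀ (by linarith), one_smul]
  have h2 : (2 * n + d : ℝ) * (2 * ((n + 1 : ℕ) : ℝ) + d - 2)⁻¹ = 1 := by
    push_cast
    rw [show (2 * (n + 1) + d - 2 : ℝ) = 2 * n + d by ring, mul_inv_cancel₀ (by linarith)]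
  rw [lower, smul_smul, h2, one_smul, raise, map_sub, Derivation.leibniz, Derivation.leibniz,
    dirDeriv_linearPoly, hv, dirDeriv_normSqPoly, h1]
  simp only [smul_eq_C_mul, smul_eq_mul, map_sub, map_add, map_mul, map_ofNat, map_natCast, map_one]
  ring

/-! ### Gaussian integrals of polynomials -/

theorem integrable_exp_neg_mul_norm_sq {b : ℝ} (hb : 0 < b) :
    Integrable (fun x : EuclideanSpace ℝ (Fin d) => Real.exp (-b * ‖x‖ ^ 2)) := by
  have h := (GaussianFourier.integrable_cexp_neg_mul_sq_norm_add (b := (b : ℂ)) (by simpa using hb)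
    0 (0 : EuclideanSpace ℝ (Fin d))).norm
  refine h.congr (.of_forall fun x => ?_)
  simp only [Complex.norm_exp, zero_mul, add_zero]
  congr 1
  norm_cast

theorem abs_mul_exp_neg_mul_sq_le {b t : ℝ} (hb : 0 < b) :
    t * Real.exp (-b * t ^ 2) ≤ 1 + 1 / b := by
  have h1 : b * t ^ 2 + 1 ≤ Real.exp (b * t ^ 2) := Real.add_one_le_exp _
  rw [neg_mul, Real.exp_neg, ← div_eq_mul_inv, div_le_iff₀ (Real.exp_pos _)]
  have h2 : (1 + 1 / b) * (b * t ^ 2 + 1) = b * t ^ 2 + 1 + t ^ 2 + 1 / b := by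
    field_simp
    ring
  have h3 : (1 + 1 / b) * (b * t ^ 2 + 1) ≤ (1 + 1 / b) * Real.exp (b * t ^ 2) := by gcongr
  have h4 : 0 < 1 / b := by positivity
  have h5 : 0 ≤ b * t ^ 2 := by positivity
  nlinarith [sq_nonneg (t - 1)]

theorem integrable_eval_mul_exp (p : MvPolynomial (Fin d) ℝ) :
    ∀ {b : ℝ}, 0 < b → Integrable
      (fun x : EuclideanSpace ℝ (Fin d) => eval (fun i => x i) p * Real.exp (-b * ‖x‖ ^ 2)) := by
  induction p using MvPolynomial.induction_on with
  | C a => intro b hb; simpa using (integrable_exp_neg_mul_norm_sq hb).const_mul a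
  | add p q hp hq => intro b hb; simpa only [map_add, add_mul] using! (hp hb).add (hq hb)
  | mul_X p i hp =>
    intro b hb
    -- Half of the Gaussian bounds the new factor `x i`, and the other half is left to the induction
    -- hypothesis; this is why `b` is quantified inside the induction.
    have hb2 : 0 < b / 2 := half_pos hb
    refine ((hp hb2).bdd_mul (f := fun x => x i * Real.exp (-(b / 2) * ‖x‖ ^ 2))
      (c := 1 + 1 / (b / 2)) ?_ ?_).congr ?_
    · exact Continuous.aestronglyMeasurable (by fun_prop)
    · refine .of_forall fun x => ?_
      rw [norm_mul, Real.norm_of_nonneg (Real.exp_pos _).le]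
      refine le_trans ?_ (abs_mul_exp_neg_mul_sq_le (t := ‖x‖) hb2)
      gcongr
      exact PiLp.norm_apply_le x i
    · refine .of_forall fun x => ?_
      have : Real.exp (-b * ‖x‖ ^ 2)
          = Real.exp (-(b / 2) * ‖x‖ ^ 2) * Real.exp (-(b / 2) * ‖x‖ ^ 2) := by
        rw [← Real.exp_add]; ring_nf
      simp only [map_mul, eval_X, this]
      ring

theorem hasLineDerivAt_eval (p : MvPolynomial (Fin d) ℝ) (i : Fin d)
    (x : EuclideanSpace ℝ (Fin d)) :
    HasLineDerivAt ℝ (fun x : EuclideanSpace ℝ (Fin d) => eval (fun i => x i) p)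
      (eval (fun i => x i) (pderiv i p)) x (EuclideanSpace.single i 1) := by
  unfold HasLineDerivAt
  induction p using MvPolynomial.induction_on with
  | C a => simpa using hasDerivAt_const (0 : ℝ) a
  | add p q hp hq => simpa only [map_add] using! hp.add hq
  | mul_X p j hp =>
    have hj : HasDerivAt (fun t : ℝ => (x + t • EuclideanSpace.single i (1 : ℝ)) j)
        (Pi.single (M := fun _ => ℝ) i (1 : ℝ) j) 0 := by
      simpa [EuclideanSpace.single, Pi.single_apply] using
        ((hasDerivAt_id (0 : ℝ)).mul_const (Pi.single (M := fun _ => ℝ) i (1 : ℝ) j)).const_add (x j)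
    have := hp.mul hj
    refine (this.congr_deriv ?_).congr_of_eventuallyEq (.of_forall fun t => by simp)
    simp only [pderiv_mul, pderiv_X, map_add, map_mul, eval_X, zero_smul, add_zero, Pi.single_apply]
    rcases eq_or_ne i j with rfl | h
    · simp
    · simp [h.symm]

theorem hasLineDerivAt_gaussian (i : Fin d) (x : EuclideanSpace ℝ (Fin d)) :
    HasLineDerivAt ℝ (fun x : EuclideanSpace ℝ (Fin d) => Real.exp (-(1 / 2) * ‖x‖ ^ 2))
      (-(x i) * Real.exp (-(1 / 2) * ‖x‖ ^ 2)) x (EuclideanSpace.single i 1) := by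
  have h := (((hasStrictFDerivAt_norm_sq x).hasFDerivAt.const_mul (-(1 / 2) : ℝ)).exp).hasLineDerivAt
    (EuclideanSpace.single i 1)
  refine (congrArg (fun y => HasLineDerivAt ℝ _ y x _) ?_).mpr h
  simp [mul_comm, EuclideanSpace.inner_single_right]

/-- Integral of a polynomial against the Gaussian weight. -/
def gaussInt (p : MvPolynomial (Fin d) ℝ) : ℝ :=
  ∫ x : EuclideanSpace ℝ (Fin d), eval (fun i => x i) p * Real.exp (-(1 / 2) * ‖x‖ ^ 2)

theorem gaussInt_add (p q : MvPolynomial (Fin d) ℝ) :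
    gaussInt (p + q) = gaussInt p + gaussInt q := by
  simp only [gaussInt, map_add, add_mul]
  exact integral_add (integrable_eval_mul_exp p (by norm_num)) (integrable_eval_mul_exp q (by norm_num))

theorem gaussInt_smul (c : ℝ) (p : MvPolynomial (Fin d) ℝ) :
    gaussInt (c • p) = c * gaussInt p := by
  simp only [gaussInt, smul_eval, mul_assoc, integral_const_mul]

theorem gaussInt_sum {ι : Type*} (s : Finset ι) (p : ι → MvPolynomial (Fin d) ℝ) :
    gaussInt (∑ i ∈ s, p i) = ∑ i ∈ s, gaussInt (p i) :=
  map_sum (AddMonoidHom.mk' gaussInt gaussInt_add) p s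

/-- Integration by parts: differentiating the weight `exp (-|x|²/2)` produces the factor `-x i`. -/
theorem gaussInt_pderiv (i : Fin d) (p : MvPolynomial (Fin d) ℝ) :
    gaussInt (pderiv i p) = gaussInt (X i * p) := by
  have hI (q : MvPolynomial (Fin d) ℝ) := integrable_eval_mul_exp q (b := 1 / 2) (by norm_num)
  have h := integral_bilinear_hasLineDerivAt_right_eq_neg_left_of_integrable
    (μ := (volume : Measure (EuclideanSpace ℝ (Fin d)))) (B := ContinuousLinearMap.mul ℝ ℝ)
    (v := EuclideanSpace.single i 1)
    (f := fun x : EuclideanSpace ℝ (Fin d) => eval (fun i => x i) p)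
    (f' := fun x : EuclideanSpace ℝ (Fin d) => eval (fun i => x i) (pderiv i p))
    (g := fun x => Real.exp (-(1 / 2) * ‖x‖ ^ 2))
    (g' := fun x => -(x i) * Real.exp (-(1 / 2) * ‖x‖ ^ 2))
    (hI (pderiv i p)) ?_ (hI p) (fun x _ => hasLineDerivAt_eval p i x)
    (fun x _ => hasLineDerivAt_gaussian i x)
  · simp only [ContinuousLinearMap.mul_apply'] at h
    rw [← neg_eq_iff_eq_neg, ← integral_neg] at h
    rw [gaussInt, gaussInt, ← h]
    refine integral_congr_ae (.of_forall fun x => ?_)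
    simp only [map_mul, eval_X]
    ring
  · refine (hI (X i * p)).neg.congr (.of_forall fun x => ?_)
    simp only [Pi.neg_apply, map_mul, eval_X, ContinuousLinearMap.mul_apply']
    ring

/-- Euler's identity writes `n p` as `∑ x i ∂ᵢp`; integrating by parts, the second derivatives of
`p` add up to its Laplacian, which is zero. -/
theorem natCast_mul_gaussInt_mul {n : ℕ} {p : MvPolynomial (Fin d) ℝ} (hp : p ∈ harmonicPoly d n)
    (q : MvPolynomial (Fin d) ℝ) :
    n * gaussInt (p * q) = ∑ i, gaussInt (pderiv i p * pderiv i q) := by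
  rw [mem_harmonicPoly] at hp
  have h1 : (n : ℝ) • (p * q) = ∑ i, X i * (pderiv i p * q) := by
    simp only [← mul_assoc, ← Finset.sum_mul, hp.1.sum_X_mul_pderiv, smul_eq_C_mul]
    simp [mul_assoc]
  have h2 : ∑ i, pderiv i (pderiv i p) * q = 0 := by
    rw [← Finset.sum_mul, ← polyLaplacian_apply, hp.2, zero_mul]
  rw [← gaussInt_smul, h1, gaussInt_sum, ← zero_add (∑ i, gaussInt (pderiv i p * pderiv i q)),
    show (0 : ℝ) = gaussInt (∑ i, pderiv i (pderiv i p) * q) by rw [h2]; simp [gaussInt],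
    gaussInt_sum, ← Finset.sum_add_distrib]
  refine Finset.sum_congr rfl fun i _ => ?_
  rw [← gaussInt_pderiv, pderiv_mul, gaussInt_add]

/-- The Dirichlet form on the right of `natCast_mul_gaussInt_mul` is symmetric in the two
polynomials, so it equals both `n` and `m` times the same integral. -/
theorem gaussInt_mul_eq_zero {n m : ℕ} (hnm : n ≠ m) {p q : MvPolynomial (Fin d) ℝ}
    (hp : p ∈ harmonicPoly d n) (hq : q ∈ harmonicPoly d m) : gaussInt (p * q) = 0 := by
  have h1 := natCast_mul_gaussInt_mul hp q
  have h2 := natCast_mul_gaussInt_mul hq p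
  simp only [mul_comm q p, mul_comm (pderiv _ q)] at h2
  have h3 : ((n : ℝ) - m) * gaussInt (p * q) = 0 := by rw [sub_mul, h1, h2, sub_self]
  exact (mul_eq_zero.1 h3).resolve_left (sub_ne_zero.2 (by exact_mod_cast hnm))

/-! ### Polar coordinates and orthogonality on the sphere -/

theorem IsHomogeneous.eval_smul {n : ℕ} {p : MvPolynomial (Fin d) ℝ} (hp : p.IsHomogeneous n)
    (r : ℝ) (y : Fin d → ℝ) : eval (fun i => r * y i) p = r ^ n * eval y p := by
  rw [eval_eq', eval_eq', Finset.mul_sum]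
  refine Finset.sum_congr rfl fun m hm => ?_
  have h : Finsupp.weight (fun _ => 1) m = n := hp (mem_support_iff.1 hm)
  rw [← Finsupp.degree_eq_weight_one, Finsupp.degree_eq_sum] at h
  simp only [mul_pow, Finset.prod_mul_distrib, Finset.prod_pow_eq_pow_sum, h]
  ring

/-- Polar coordinates for the Gaussian integral of a homogeneous polynomial. -/
theorem gaussInt_eq_sphere (hd : d ≠ 0) {n : ℕ} {p : MvPolynomial (Fin d) ℝ}
    (hp : p.IsHomogeneous n) :
    gaussInt p = (∫ x, restrictPoly d p x ∂(surf d)) *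
      ∫ r : Set.Ioi (0 : ℝ), (r : ℝ) ^ n * Real.exp (-(1 / 2) * (r : ℝ) ^ 2)
        ∂(Measure.volumeIoiPow (d - 1)) := by
  have : Nontrivial (EuclideanSpace ℝ (Fin d)) :=
    Module.nontrivial_of_finrank_pos (R := ℝ) (by rw [finrank_euclideanSpace_fin]; omega)
  rw [← integral_prod_mul (μ := surf d) (ν := Measure.volumeIoiPow (d - 1))
    (fun x => restrictPoly d p x)
    (fun r : Set.Ioi (0 : ℝ) => (r : ℝ) ^ n * Real.exp (-(1 / 2) * (r : ℝ) ^ 2))]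
  have h := (volume : Measure (EuclideanSpace ℝ (Fin d))).measurePreserving_homeomorphUnitSphereProd
  rw [finrank_euclideanSpace_fin] at h
  have h2 := h.integral_comp
    (homeomorphUnitSphereProd (EuclideanSpace ℝ (Fin d))).measurableEmbedding
    (fun z : Sph d × Set.Ioi (0 : ℝ) => restrictPoly d p z.1 *
      ((z.2 : ℝ) ^ n * Real.exp (-(1 / 2) * (z.2 : ℝ) ^ 2)))
  have h3 : gaussInt p = ∫ x : ({0}ᶜ : Set (EuclideanSpace ℝ (Fin d))),
      eval (fun i => x.1 i) p * Real.exp (-(1 / 2) * ‖x.1‖ ^ 2) ∂(volume.comap Subtype.val) := by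
    rw [integral_subtype_comap (measurableSet_singleton (0 : EuclideanSpace ℝ (Fin d))).compl
      fun x => eval (fun i => x i) p * Real.exp (-(1 / 2) * ‖x‖ ^ 2), restrict_compl_singleton,
      gaussInt]
  rw [← h2, h3]
  refine congrArg (integral _) (funext fun x => ?_)
  have hx : ‖(x : EuclideanSpace ℝ (Fin d))‖ ≠ 0 := norm_ne_zero_iff.2 x.2
  simp only [restrictPoly_apply, homeomorphUnitSphereProd_apply_snd_coe]
  rw [← mul_assoc]
  congr 1
  rw [mul_comm, ← IsHomogeneous.eval_smul hp]
  congr 2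
  ext i
  simp [hx]

/-- Only positivity matters: the radial factor can be cancelled, so a vanishing Gaussian integral
forces a vanishing integral over the sphere. -/
theorem radialInt_pos (n k : ℕ) :
    0 < ∫ r : Set.Ioi (0 : ℝ), (r : ℝ) ^ n * Real.exp (-(1 / 2) * (r : ℝ) ^ 2)
        ∂(Measure.volumeIoiPow k) := by
  simp only [Measure.volumeIoiPow, ENNReal.ofReal]
  rw [integral_withDensity_eq_integral_smul (by fun_prop),
    integral_subtype_comap measurableSet_Ioi fun a : ℝ =>
      Real.toNNReal (a ^ k) • (a ^ n * Real.exp (-(1 / 2) * a ^ 2)),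
    setIntegral_congr_fun (g := fun a : ℝ => a ^ ((k + n : ℕ) : ℝ) * Real.exp (-(1 / 2) * a ^ (2 : ℝ)))
      measurableSet_Ioi fun x hx => ?_]
  · rw [integral_rpow_mul_exp_neg_mul_rpow (by norm_num) (lt_of_lt_of_le (by norm_num) (Nat.cast_nonneg _)) (by norm_num)]
    have : 0 < Real.Gamma ((((k + n : ℕ) : ℝ) + 1) / 2) := Real.Gamma_pos_of_pos (by positivity)
    positivity
  · simp only
    rw [NNReal.smul_def, Real.coe_toNNReal _ (pow_nonneg (le_of_lt hx) _), Real.rpow_natCast, pow_add,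
      smul_eq_mul, mul_assoc, Real.rpow_two]

theorem integral_sphere_mul_eq_zero (hd : d ≠ 0) {n m : ℕ} (hnm : n ≠ m) {p q : MvPolynomial (Fin d) ℝ}
    (hp : p ∈ harmonicPoly d n) (hq : q ∈ harmonicPoly d m) :
    ∫ x, restrictPoly d p x * restrictPoly d q x ∂(surf d) = 0 := by
  have h := gaussInt_eq_sphere hd ((mem_harmonicPoly.1 hp).1.mul (mem_harmonicPoly.1 hq).1)
  rw [gaussInt_mul_eq_zero hnm hp hq] at h
  simpa using (mul_eq_zero.1 h.symm).resolve_right (radialInt_pos _ _).ne'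

/-! ### Multiplication operators on `L²` of the sphere -/

/-- Multiplication by a continuous function, as a bounded operator on `L²(S^{d-1})`. -/
def mulOp (φ : C(Sph d, ℝ)) : L2 d →L[ℝ] L2 d :=
  (ContinuousLinearMap.mul ℝ ℝ).holderL (surf d) ∞ 2 2 (ContinuousMap.toLp (E := ℝ) ∞ (surf d) ℝ φ)

theorem coeFn_mulOp (φ : C(Sph d, ℝ)) (u : L2 d) :
    mulOp φ u =ᵐ[surf d] fun x => φ x * u x := by
  filter_upwards [(ContinuousLinearMap.mul ℝ ℝ).coeFn_holder (r := 2)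
    (ContinuousMap.toLp (E := ℝ) ∞ (surf d) ℝ φ) u,
    ContinuousMap.coeFn_toLp (p := ∞) (𝕜 := ℝ) (surf d) φ] with x h1 h2
  rw [mulOp, ContinuousLinearMap.holderL_apply_apply, h1, h2, ContinuousLinearMap.mul_apply']

theorem inner_mulOp_left (φ : C(Sph d, ℝ)) (u v : L2 d) :
    inner ℝ (mulOp φ u) v = ∫ x, φ x * (u x * v x) ∂(surf d) := by
  rw [L2.inner_def]
  refine integral_congr_ae ?_
  filter_upwards [coeFn_mulOp φ u] with x hx
  rw [hx]
  simp only [RCLike.inner_apply, conj_trivial]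
  ring

theorem inner_mulOp_comm (φ : C(Sph d, ℝ)) (u v : L2 d) :
    inner ℝ (mulOp φ u) v = inner ℝ u (mulOp φ v) := by
  rw [real_inner_comm (mulOp φ v), inner_mulOp_left, inner_mulOp_left]
  simp only [mul_comm (u _)]

/-- The class in `L²(S^{d-1})` of the restriction of a polynomial to the sphere. -/
def polyL2 (d : ℕ) : MvPolynomial (Fin d) ℝ →ₗ[ℝ] L2 d :=
  (ContinuousMap.toLp (E := ℝ) 2 (surf d) ℝ).toLinearMap ∘ₗ (restrictPoly d).toLinearMap

theorem coeFn_polyL2 (p : MvPolynomial (Fin d) ℝ) :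
    polyL2 d p =ᵐ[surf d] restrictPoly d p :=
  ContinuousMap.coeFn_toLp (p := 2) (𝕜 := ℝ) (surf d) (restrictPoly d p)

theorem inner_polyL2 (p q : MvPolynomial (Fin d) ℝ) :
    inner ℝ (polyL2 d p) (polyL2 d q) = ∫ x, restrictPoly d p x * restrictPoly d q x ∂(surf d) := by
  rw [L2.inner_def]
  refine integral_congr_ae ?_
  filter_upwards [coeFn_polyL2 p, coeFn_polyL2 q] with x hp hq
  rw [hp, hq]
  simp [mul_comm]

theorem inner_polyL2_eq_zero (hd : d ≠ 0) {n m : ℕ} (hnm : n ≠ m) {p q : MvPolynomial (Fin d) ℝ}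
    (hp : p ∈ harmonicPoly d n) (hq : q ∈ harmonicPoly d m) :
    inner ℝ (polyL2 d p) (polyL2 d q) = 0 := by
  rw [inner_polyL2, integral_sphere_mul_eq_zero hd hnm hp hq]

theorem mulOp_polyL2 (p q : MvPolynomial (Fin d) ℝ) :
    mulOp (restrictPoly d p) (polyL2 d q) = polyL2 d (p * q) := by
  refine Lp.ext ?_
  filter_upwards [coeFn_mulOp (restrictPoly d p) (polyL2 d q), coeFn_polyL2 q,
    coeFn_polyL2 (p * q)] with x h1 h2 h3
  rw [h1, h2, h3, map_mul, ContinuousMap.mul_apply]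

theorem restrictPoly_linearPoly (v : EuclideanSpace ℝ (Fin d)) (x : Sph d) :
    restrictPoly d (linearPoly d v) x = inner ℝ (x : EuclideanSpace ℝ (Fin d)) v := by
  rw [restrictPoly_apply, PiLp.inner_apply]
  simp [linearPoly]

theorem restrictPoly_normSqPoly : restrictPoly d (normSqPoly d) = 1 := by
  ext x
  have h := EuclideanSpace.real_norm_sq_eq (x : EuclideanSpace ℝ (Fin d))
  rw [norm_eq_of_mem_sphere] at h
  rw [restrictPoly_apply]
  simp [normSqPoly, ← sq, ← h]

theorem polyL2_normSqPoly_mul (p : MvPolynomial (Fin d) ℝ) :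
    polyL2 d (normSqPoly d * p) = polyL2 d p := by
  simp [polyL2, restrictPoly_normSqPoly]

/-- The correction `|x|²` in `raise` restricts to `1` on the sphere, so it is undone by adding
`lower`. -/
theorem mulOp_linearPoly (v : Fin d → ℝ) (n : ℕ) (p : MvPolynomial (Fin d) ℝ) :
    mulOp (restrictPoly d (linearPoly d v)) (polyL2 d p) =
      polyL2 d (raise d v n p) + polyL2 d (lower d v n p) := by
  rw [mulOp_polyL2, raise, map_sub, polyL2_normSqPoly_mul, sub_add_cancel]

theorem inner_raise_mulOp (hd : 3 ≤ d) (v : Fin d → ℝ) {n : ℕ} {p q : MvPolynomial (Fin d) ℝ}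
    (hp : p ∈ harmonicPoly d n) (hq : q ∈ harmonicPoly d (n + 1)) :
    inner ℝ (mulOp (restrictPoly d (linearPoly d v)) (polyL2 d p)) (polyL2 d q) =
      inner ℝ (polyL2 d (raise d v n p)) (polyL2 d q) := by
  rw [mulOp_linearPoly v n, inner_add_left,
    inner_polyL2_eq_zero (by omega) (by omega) (lower_mem_harmonicPoly hp v) hq, add_zero]

theorem inner_lower_mulOp (hd : 3 ≤ d) (v : Fin d → ℝ) {n : ℕ} {p q : MvPolynomial (Fin d) ℝ}
    (hp : p ∈ harmonicPoly d n) (hq : q ∈ harmonicPoly d (n - 1)) :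
    inner ℝ (mulOp (restrictPoly d (linearPoly d v)) (polyL2 d p)) (polyL2 d q) =
      inner ℝ (polyL2 d (lower d v n p)) (polyL2 d q) := by
  rw [mulOp_linearPoly v n, inner_add_left,
    inner_polyL2_eq_zero (by omega) (by omega) (raise_mem_harmonicPoly hd hp v) hq, zero_add]

/-! ### Norm bound for the raising operator -/

/-- This is `lower_raise` paired with `p`. Raising and lowering are adjoint, because each is a
component of the same symmetric multiplication operator, and the last term of `lower_raise` drops
out by orthogonality of degrees. -/
theorem norm_sq_raise (hd : 3 ≤ d) {v : Fin d → ℝ} (hv : ∑ i, v i * v i = 1) {n : ℕ}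
    {p : MvPolynomial (Fin d) ℝ} (hp : p ∈ harmonicPoly d n) :
    (2 * n + d : ℝ) * ‖polyL2 d (raise d v n p)‖ ^ 2 =
      ‖polyL2 d p‖ ^ 2 + (2 * n + d - 4 : ℝ) * ‖polyL2 d (lower d v n p)‖ ^ 2 := by
  have hr := raise_mem_harmonicPoly hd hp v
  have hl := lower_mem_harmonicPoly hp v
  have h1 : ‖polyL2 d (raise d v n p)‖ ^ 2 =
      inner ℝ (polyL2 d (lower d v (n + 1) (raise d v n p))) (polyL2 d p) := by
    rw [← inner_lower_mulOp hd v hr hp, inner_mulOp_comm, real_inner_comm,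
      inner_raise_mulOp hd v hp hr, real_inner_self_eq_norm_sq]
  have h2 : inner ℝ (polyL2 d (dirDeriv d v (lower d v n p))) (polyL2 d p) = 0 := by
    rcases Nat.eq_zero_or_pos n with rfl | hn
    · rw [lower_eq_zero hp, map_zero, map_zero, inner_zero_left]
    · exact inner_polyL2_eq_zero (by omega) (by omega) (dirDeriv_mem_harmonicPoly hl v) hp
  have h3 : inner ℝ (polyL2 d (linearPoly d v * lower d v n p)) (polyL2 d p) =
      ‖polyL2 d (lower d v n p)‖ ^ 2 := by
    rw [← mulOp_polyL2, inner_mulOp_comm, real_inner_comm, inner_lower_mulOp hd v hp hl,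
      real_inner_self_eq_norm_sq]
  rw [h1, ← real_inner_smul_left, ← map_smul, lower_raise hv hd, map_sub, map_add, map_smul,
    polyL2_normSqPoly_mul, inner_sub_left, inner_add_left, real_inner_smul_left, h2, h3,
    real_inner_self_eq_norm_sq, sub_zero]

/-- The constant `1/2` reproduces itself: `1 + (2n + d - 4)/4 = (2n + d)/4`. The hypothesis `d ≥ 4`
is what starts the induction, where the squared norm of raising is `1/d`. -/
theorem norm_raise_le (hd : 4 ≤ d) {v : Fin d → ℝ} (hv : ∑ i, v i * v i = 1) (n : ℕ) :
    ∀ p ∈ harmonicPoly d n, ‖polyL2 d (raise d v n p)‖ ≤ 1 / 2 * ‖polyL2 d p‖ := by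
  have hd' : (4 : ℝ) ≤ d := by exact_mod_cast hd
  induction n with
  | zero =>
    intro p hp
    have h := norm_sq_raise (by omega) hv hp
    rw [lower_eq_zero hp, map_zero, norm_zero] at h
    refine abs_le_of_sq_le_sq' ?_ (by positivity) |>.2
    norm_num at h
    nlinarith [sq_nonneg ‖polyL2 d (raise d v 0 p)‖]
  | succ n ih =>
    intro p hp
    have h := norm_sq_raise (by omega) hv hp
    have hl : lower d v (n + 1) p ∈ harmonicPoly d n := lower_mem_harmonicPoly hp v
    -- Adjointness: lowering from degree `n + 1` inherits the bound already known for raising from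
    -- degree `n`.
    have h1 : ‖polyL2 d (lower d v (n + 1) p)‖ ^ 2 ≤
        1 / 2 * ‖polyL2 d (lower d v (n + 1) p)‖ * ‖polyL2 d p‖ := by
      rw [← real_inner_self_eq_norm_sq, ← inner_lower_mulOp (by omega) v hp hl, inner_mulOp_comm,
        real_inner_comm, inner_raise_mulOp (by omega) v hl hp]
      exact (real_inner_le_norm _ _).trans (mul_le_mul_of_nonneg_right (ih _ hl) (norm_nonneg _))
    have h2 : ‖polyL2 d (lower d v (n + 1) p)‖ ≤ 1 / 2 * ‖polyL2 d p‖ := by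
      rcases (norm_nonneg (polyL2 d (lower d v (n + 1) p))).eq_or_lt with h0 | h0
      · rw [← h0]; positivity
      · nlinarith
    have h3 : ‖polyL2 d (lower d v (n + 1) p)‖ ^ 2 ≤ (1 / 2 * ‖polyL2 d p‖) ^ 2 := by gcongr
    refine abs_le_of_sq_le_sq' ?_ (by positivity) |>.2
    have h4 : (0 : ℝ) ≤ 2 * (n + 1 : ℕ) + d - 4 := by
      have : (0 : ℝ) ≤ (n + 1 : ℕ) := Nat.cast_nonneg _
      linarith
    have h5 := mul_le_mul_of_nonneg_left h3 h4
    have h6 : (0 : ℝ) < 2 * (n + 1 : ℕ) + d := by linarith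
    refine le_of_mul_le_mul_left ?_ h6
    rw [h]
    linarith

/-! ### Hilbert sum decomposition into spherical harmonics -/

theorem mem_sphericalHarmonics {n : ℕ} {u : L2 d} :
    u ∈ sphericalHarmonics d n ↔ ∃ p ∈ harmonicPoly d n, polyL2 d p = u :=
  Submodule.mem_map

theorem inner_mulOp_le (hd : 4 ≤ d) {v : Fin d → ℝ} (hv : ∑ i, v i * v i = 1) {n : ℕ} {y z : L2 d}
    (hy : y ∈ sphericalHarmonics d n) (hz : z ∈ sphericalHarmonics d (n + 1)) :
    inner ℝ (mulOp (restrictPoly d (linearPoly d v)) y) z ≤ 1 / 2 * ‖y‖ * ‖z‖ := by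
  obtain ⟨p, hp, rfl⟩ := mem_sphericalHarmonics.1 hy
  obtain ⟨q, hq, rfl⟩ := mem_sphericalHarmonics.1 hz
  rw [inner_raise_mulOp (by omega) v hp hq]
  exact (real_inner_le_norm _ _).trans
    (mul_le_mul_of_nonneg_right (norm_raise_le hd hv n p hp) (norm_nonneg _))

theorem inner_mulOp_eq_zero (hd : 3 ≤ d) (v : Fin d → ℝ) {n m : ℕ} (h1 : m ≠ n + 1)
    (h2 : n ≠ m + 1) {y z : L2 d}
    (hy : y ∈ sphericalHarmonics d n) (hz : z ∈ sphericalHarmonics d m) :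
    inner ℝ (mulOp (restrictPoly d (linearPoly d v)) y) z = 0 := by
  obtain ⟨p, hp, rfl⟩ := mem_sphericalHarmonics.1 hy
  obtain ⟨q, hq, rfl⟩ := mem_sphericalHarmonics.1 hz
  rw [mulOp_linearPoly v n, inner_add_left,
    inner_polyL2_eq_zero (by omega) h1.symm (raise_mem_harmonicPoly hd hp v) hq, zero_add]
  rcases Nat.eq_zero_or_pos n with rfl | hn
  · rw [lower_eq_zero hp, map_zero, inner_zero_left]
  · exact inner_polyL2_eq_zero (by omega) (by omega) (lower_mem_harmonicPoly hp v) hq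

theorem orthogonalFamily_sphericalHarmonics (hd : d ≠ 0) :
    OrthogonalFamily ℝ (fun n => sphericalHarmonics d n)
      fun n => (sphericalHarmonics d n).subtypeₗᵢ := by
  intro n m hnm y z
  obtain ⟨p, hp, hpy⟩ := mem_sphericalHarmonics.1 y.2
  obtain ⟨q, hq, hqz⟩ := mem_sphericalHarmonics.1 z.2
  change inner ℝ (y : L2 d) (z : L2 d) = 0
  rw [← hpy, ← hqz]
  exact inner_polyL2_eq_zero hd hnm hp hq

/-- The span of the spherical harmonics is stable under multiplication by each coordinate, since the
product is a raised plus a lowered harmonic. It contains the constants, hence every polynomial. -/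
theorem polyL2_mem_iSup (hd : 3 ≤ d) (p : MvPolynomial (Fin d) ℝ) :
    polyL2 d p ∈ ⨆ n, sphericalHarmonics d n := by
  have hmem {n : ℕ} {q : MvPolynomial (Fin d) ℝ} (hq : q ∈ harmonicPoly d n) :
      polyL2 d q ∈ ⨆ n, sphericalHarmonics d n :=
    Submodule.mem_iSup_of_mem n (mem_sphericalHarmonics.2 ⟨q, hq, rfl⟩)
  induction p using MvPolynomial.induction_on with
  | C a =>
    refine hmem (n := 0) (mem_harmonicPoly.2 ⟨isHomogeneous_C _ _, ?_⟩)
    simp [polyLaplacian_apply]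
  | add p q hp hq => rw [map_add]; exact Submodule.add_mem _ hp hq
  | mul_X p i hp =>
    have hX : X i = linearPoly d (Pi.single i 1) := by
      simp [linearPoly, Pi.single_apply, ite_smul]
    rw [mul_comm, ← mulOp_polyL2, hX]
    have hle : (⨆ n, sphericalHarmonics d n) ≤ (⨆ n, sphericalHarmonics d n).comap
        (mulOp (restrictPoly d (linearPoly d (Pi.single i 1)))).toLinearMap := by
      refine iSup_le fun n y hy => ?_
      obtain ⟨q, hq, rfl⟩ := mem_sphericalHarmonics.1 hy
      rw [Submodule.mem_comap, ContinuousLinearMap.coe_coe, mulOp_linearPoly _ n]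
      exact Submodule.add_mem _ (hmem (raise_mem_harmonicPoly hd hq _))
        (hmem (lower_mem_harmonicPoly hq _))
    exact hle hp

/-- Stone–Weierstrass, as coordinates separate points, followed by density of continuous functions
in `L²`. -/
theorem denseRange_polyL2 : DenseRange (polyL2 d) := by
  have h1 : (restrictPoly d).range.topologicalClosure = ⊤ := by
    refine ContinuousMap.subalgebra_topologicalClosure_eq_top_of_separatesPoints _ ?_
    intro x y hxy
    have : ∃ i, (x : EuclideanSpace ℝ (Fin d)) i ≠ (y : EuclideanSpace ℝ (Fin d)) i := by
      by_contra! h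
      exact hxy (Subtype.ext (PiLp.ext h))
    obtain ⟨i, hi⟩ := this
    refine ⟨restrictPoly d (X i), ⟨restrictPoly d (X i), ⟨X i, rfl⟩, rfl⟩, ?_⟩
    simpa [restrictPoly_apply] using hi
  have h2 : DenseRange (restrictPoly d) := by
    rw [DenseRange, dense_iff_closure_eq]
    have := congrArg (fun A : Subalgebra ℝ C(Sph d, ℝ) => (A : Set C(Sph d, ℝ))) h1
    simpa [Subalgebra.topologicalClosure_coe] using this
  exact (ContinuousMap.toLp_denseRange ℝ (surf d) (p := 2) ℝ (by simp)).comp h2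
    (ContinuousLinearMap.continuous _)

theorem isHilbertSum_sphericalHarmonics (hd : 3 ≤ d) :
    IsHilbertSum ℝ (fun n => sphericalHarmonics d n)
      fun n => (sphericalHarmonics d n).subtypeₗᵢ := by
  refine IsHilbertSum.mkInternal _ (orthogonalFamily_sphericalHarmonics (by omega)) ?_
  rw [top_le_iff, ← Submodule.dense_iff_topologicalClosure_eq_top]
  exact denseRange_polyL2.mono (Set.range_subset_iff.2 (polyL2_mem_iSup hd))

/-! ### Discrete Hardy inequality -/

open Filter Topology

/-- A discrete Hardy inequality in summed form. -/
theorem sum_div_sq_le (a : ℕ → ℝ) (h0 : a 0 = 0) (N : ℕ) :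
    1 / 8 * ∑ n ∈ Finset.range (N + 1), a n ^ 2 / (n : ℝ) ^ 2 ≤
      ∑ n ∈ Finset.range (N + 1), a n ^ 2 - ∑ n ∈ Finset.range N, a n * a (n + 1) := by
  rcases N with _ | N
  · simp [h0]
  -- The induction needs a reserve: a multiple of the last square, with weight slightly above `1/2`,
  -- kept to absorb the next cross term. The term `n = 0` of the first sum is zero.
  suffices h : 1 / 8 * ∑ n ∈ Finset.range (N + 2), a n ^ 2 / (n : ℝ) ^ 2
      + 1 / 2 * (1 + 1 / (2 * ((N : ℝ) + 1))) * a (N + 1) ^ 2 ≤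
      ∑ n ∈ Finset.range (N + 2), a n ^ 2 - ∑ n ∈ Finset.range (N + 1), a n * a (n + 1) by
    have : 0 ≤ 1 / 2 * (1 + 1 / (2 * ((N : ℝ) + 1))) * a (N + 1) ^ 2 := by positivity
    linarith
  induction N with
  | zero =>
    simp [Finset.sum_range_succ, h0]
    nlinarith [sq_nonneg (a 1)]
  | succ N ih =>
    rw [Finset.sum_range_succ _ (N + 2), Finset.sum_range_succ _ (N + 2),
      Finset.sum_range_succ (fun n => a n * a (n + 1)) (N + 1)]
    push_cast
    set x := a (N + 1)
    simp only [show a (N + 1 + 1) = a (N + 2) from rfl]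
    set y := a (N + 2)
    have hN : (0 : ℝ) ≤ N := N.cast_nonneg
    set α : ℝ := 1 + 1 / (2 * ((N : ℝ) + 1)) with hα
    have hα0 : 0 < α := by positivity
    -- AM-GM weighted by `α`, so that the `x ^ 2` part is exactly the reserve from the previous
    -- step.
    have h1 : x * y ≤ 1 / 2 * α * x ^ 2 + 1 / 2 * (1 / α) * y ^ 2 := by
      have : 1 / 2 * α * x ^ 2 + 1 / 2 * (1 / α) * y ^ 2 - x * y
          = 1 / 2 * (1 / α) * (α * x - y) ^ 2 := by field_simp; ring
      have : 0 ≤ 1 / 2 * (1 / α) * (α * x - y) ^ 2 := by positivity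
      linarith
    -- Source of the `1/8`: half of `1/(2N+3) - 1/(2N+4)` is at least `1/(8 (N+2)²)`.
    have h2 : 1 / 8 * (1 / ((N : ℝ) + 2) ^ 2) + 1 / 2 * (1 + 1 / (2 * ((N : ℝ) + 1 + 1)))
        + 1 / 2 * (1 / α) ≤ 1 := by
      have e : 1 / α = 1 - 1 / (2 * N + 3) := by
        rw [hα]; field_simp; ring
      have e2 : 1 / (2 * N + 3 : ℝ) - 1 / (2 * ((N : ℝ) + 1 + 1))
          = 1 / ((2 * N + 3) * (2 * (N + 2))) := by field_simp; ring
      have e3 : 1 / ((2 * N + 4 : ℝ) * (2 * (N + 2))) ≤ 1 / ((2 * N + 3) * (2 * (N + 2))) := by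
        gcongr; norm_num
      have e4 : 1 / ((2 * N + 4 : ℝ) * (2 * (N + 2))) = 1 / 4 * (1 / ((N : ℝ) + 2) ^ 2) := by
        field_simp; ring
      rw [e]
      linarith
    have h3 := mul_le_mul_of_nonneg_right h2 (sq_nonneg y)
    have h4 : y ^ 2 / ((N : ℝ) + 2) ^ 2 = 1 / ((N : ℝ) + 2) ^ 2 * y ^ 2 := by ring
    rw [h4]
    linarith

/-! ### The inequality for a fixed direction -/

theorem proj_mem (n : ℕ) (u : L2 d) : proj d n u ∈ sphericalHarmonics d n :=
  Submodule.starProjection_apply_mem _ u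

theorem hasSum_proj (hd : 3 ≤ d) (u : L2 d) : HasSum (fun n => proj d n u) u := by
  have hV := isHilbertSum_sphericalHarmonics hd
  set w := hV.linearIsometryEquiv u with hw
  have hs : HasSum (fun n => (w n : L2 d)) u := by
    simpa [hw] using! hV.hasSum_linearIsometryEquiv_symm w
  -- Orthogonality identifies the abstract Hilbert sum coordinates with the projections.
  have hp (m : ℕ) : proj d m u = w m := by
    have h1 := hs.mapL (proj d m)
    have h2 : HasSum (fun n => proj d m (w n)) (proj d m (w m)) := by
      refine hasSum_single m fun n hn => ?_
      rw [proj, Submodule.starProjection_apply_eq_zero_iff]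
      intro z hz
      exact hV.OrthogonalFamily hn.symm ⟨z, hz⟩ (w n)
    rw [h1.unique h2, proj, Submodule.starProjection_eq_self_iff]
    exact (w m).2
  simpa only [hp] using hs

theorem norm_sq_sum_proj (hd : d ≠ 0) (u : L2 d) (s : Finset ℕ) :
    ‖∑ n ∈ s, proj d n u‖ ^ 2 = ∑ n ∈ s, ‖proj d n u‖ ^ 2 :=
  (orthogonalFamily_sphericalHarmonics hd).norm_sum
    (fun n => (⟨proj d n u, proj_mem n u⟩ : sphericalHarmonics d n)) s

/-- The quadratic form is tridiagonal with zero diagonal. By symmetry each neighbouring pair occurs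
twice, which cancels the factor `1/2`. -/
theorem inner_mulOp_sum_proj_le (hd : 4 ≤ d) {v : Fin d → ℝ} (hv : ∑ i, v i * v i = 1)
    (u : L2 d) (N : ℕ) :
    inner ℝ (mulOp (restrictPoly d (linearPoly d v)) (∑ n ∈ Finset.range (N + 1), proj d n u))
      (∑ n ∈ Finset.range (N + 1), proj d n u) ≤
      ∑ n ∈ Finset.range N, ‖proj d n u‖ * ‖proj d (n + 1) u‖ := by
  set M := mulOp (restrictPoly d (linearPoly d v))
  have h0 (n : ℕ) : inner ℝ (M (proj d n u)) (proj d n u) = 0 :=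
    inner_mulOp_eq_zero (by omega) v (by omega) (by omega) (proj_mem n u) (proj_mem n u)
  induction N with
  | zero => simp [h0]
  | succ N ih =>
    have h1 : inner ℝ (M (∑ n ∈ Finset.range (N + 1), proj d n u)) (proj d (N + 1) u) ≤
        1 / 2 * ‖proj d N u‖ * ‖proj d (N + 1) u‖ := by
      rw [map_sum, sum_inner, Finset.sum_range_succ, Finset.sum_eq_zero, zero_add]
      · exact inner_mulOp_le hd hv (proj_mem N u) (proj_mem (N + 1) u)
      · intro n hn
        rw [Finset.mem_range] at hn
        exact inner_mulOp_eq_zero (by omega) v (by omega) (by omega) (proj_mem n u)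
          (proj_mem (N + 1) u)
    rw [Finset.sum_range_succ _ (N + 1),
      Finset.sum_range_succ (fun n => ‖proj d n u‖ * ‖proj d (n + 1) u‖) N, map_add, inner_add_left,
      inner_add_right, inner_add_right, h0, inner_mulOp_comm _ (proj d (N + 1) u),
      real_inner_comm (M _) (proj d (N + 1) u)]
    linarith

theorem proj_zero_eq_zero {f : L2 d} (hf : ∫ x, f x ∂(surf d) = 0) : proj d 0 f = 0 := by
  rw [proj, Submodule.starProjection_apply_eq_zero_iff]
  intro z hz
  obtain ⟨p, hp, rfl⟩ := mem_sphericalHarmonics.1 hz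
  have h := (mem_harmonicPoly.1 hp).1
  rw [← totalDegree_zero_iff_isHomogeneous, totalDegree_eq_zero_iff_eq_C] at h
  rw [L2.inner_def, ← mul_zero (coeff 0 p), ← hf, ← integral_const_mul]
  refine integral_congr_ae ?_
  filter_upwards [coeFn_polyL2 p] with x hx
  rw [hx, restrictPoly_apply, h]
  simp [mul_comm]

/-- For `n ≥ 1` this is `n (n + d - 2) ≥ n²`. For `n = 0` the right side is zero by the division
convention, and the mean-zero condition kills the left side. -/
theorem norm_sq_proj_le (hd : 2 ≤ d) {f g : L2 d} (hfg : IsFracLaplaceBeltrami d (1 / 2) f g)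
    (hf : ∫ x, f x ∂(surf d) = 0) (n : ℕ) :
    ‖proj d n f‖ ^ 2 ≤ ‖proj d n g‖ ^ 2 / (n : ℝ) ^ 2 := by
  rcases Nat.eq_zero_or_pos n with rfl | hn
  · rw [proj_zero_eq_zero hf]; simp
  · have hd' : (2 : ℝ) ≤ d := by exact_mod_cast hd
    have hn' : (1 : ℝ) ≤ n := by exact_mod_cast hn
    have hm : (0 : ℝ) ≤ n * (n + d - 2) := mul_nonneg (by linarith) (by linarith)
    rw [hfg.2 n hn, norm_smul, mul_pow, Real.norm_eq_abs, sq_abs, ← Real.sqrt_eq_rpow,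
      Real.sq_sqrt hm, le_div_iff₀ (by positivity), mul_comm]
    gcongr
    nlinarith

theorem norm_sq_le (hd : 4 ≤ d) {v : Fin d → ℝ} (hv : ∑ i, v i * v i = 1) {f g : L2 d}
    (hfg : IsFracLaplaceBeltrami d (1 / 2) f g) (hf : ∫ x, f x ∂(surf d) = 0) :
    ‖f‖ ^ 2 ≤ 8 * (‖g‖ ^ 2 - inner ℝ (mulOp (restrictPoly d (linearPoly d v)) g) g) := by
  set M := mulOp (restrictPoly d (linearPoly d v))
  have hlim (u : L2 d) : Tendsto (fun N => ∑ n ∈ Finset.range (N + 1), proj d n u) atTop (𝓝 u) :=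
    (hasSum_proj (by omega) u).tendsto_sum_nat.comp (tendsto_add_atTop_nat 1)
  have hg := hlim g
  -- Both sides are continuous in `L²`, so it is enough to treat the truncations to degrees at most
  -- `N`.
  refine le_of_tendsto_of_tendsto' ((hlim f).norm.pow 2)
    (((hg.norm.pow 2).sub (((M.continuous.tendsto g).comp hg).inner hg)).const_mul 8) fun N => ?_
  have h1 := sum_div_sq_le (fun n => ‖proj d n g‖) (by simp [hfg.1]) N
  have h2 := inner_mulOp_sum_proj_le hd hv g N
  have h3 : ∑ n ∈ Finset.range (N + 1), ‖proj d n f‖ ^ 2 ≤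
      ∑ n ∈ Finset.range (N + 1), ‖proj d n g‖ ^ 2 / (n : ℝ) ^ 2 :=
    Finset.sum_le_sum fun n _ => norm_sq_proj_le (by omega) hfg hf n
  rw [norm_sq_sum_proj (by omega), norm_sq_sum_proj (by omega), Function.comp_apply]
  linarith

/-! ### The weighted integral and its minimum -/

theorem integral_abs_sq (f : L2 d) : ∫ x, |f x| ^ 2 ∂(surf d) = ‖f‖ ^ 2 := by
  rw [← real_inner_self_eq_norm_sq, L2.inner_def]
  simp [sq]

theorem integrable_abs_sq (f : L2 d) : Integrable (fun x => |f x| ^ 2) (surf d) := by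
  simpa using (Lp.memLp f).integrable_norm_pow (by norm_num)

theorem integral_one_sub_inner_mul (e : Sph d) (g : L2 d) :
    ∫ x, (1 - inner ℝ (x : EuclideanSpace ℝ (Fin d)) (e : EuclideanSpace ℝ (Fin d))) * |g x| ^ 2
        ∂(surf d) =
      ‖g‖ ^ 2 - inner ℝ (mulOp (restrictPoly d (linearPoly d (e : EuclideanSpace ℝ (Fin d)))) g)
        g := by
  rw [inner_mulOp_left, ← integral_abs_sq, ← integral_sub (integrable_abs_sq g)]
  · simp only [restrictPoly_linearPoly, sq_abs, sub_mul, one_mul, ← sq]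
  · simp only [← sq, ← sq_abs (g _)]
    refine (integrable_abs_sq g).bdd_mul (c := ‖restrictPoly d (linearPoly d e.1)‖)
      (ContinuousMap.continuous _).aestronglyMeasurable
      (.of_forall fun x => ContinuousMap.norm_coe_le_norm _ x)

/-- Dominated convergence, as the weight is at most `2`. Compactness of the sphere then gives a
minimizer. -/
theorem continuous_integral_one_sub_inner_mul (g : L2 d) :
    Continuous fun e : Sph d =>
      ∫ x, (1 - inner ℝ (x : EuclideanSpace ℝ (Fin d)) (e : EuclideanSpace ℝ (Fin d))) * |g x| ^ 2
        ∂(surf d) := by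
  refine continuous_of_dominated (bound := fun x => 2 * |g x| ^ 2) (fun e => ?_)
    (fun e => .of_forall fun x => ?_) ((integrable_abs_sq g).const_mul 2)
    (.of_forall fun x => by fun_prop)
  · exact (Continuous.aestronglyMeasurable (by fun_prop)).mul (integrable_abs_sq g).1
  · rw [norm_mul, Real.norm_of_nonneg (sq_nonneg _)]
    gcongr
    refine (norm_sub_le _ _).trans ?_
    have := norm_inner_le_norm (𝕜 := ℝ) (x : EuclideanSpace ℝ (Fin d)) e
    rw [norm_eq_of_mem_sphere, norm_eq_of_mem_sphere] at this
    norm_num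
    norm_num at this
    linarith

end HardyRellich
end

theorem mainTheorem4 :
    ∃ c : ℕ → ℝ, c 4 = 8 ∧
      ∀ d : ℕ, 4 ≤ d → 0 < c d ∧
        ∀ f g : HardyRellich.L2 d,
          f ∈ HardyRellich.sobolevW2 d 1 →
          HardyRellich.IsFracLaplaceBeltrami d (1 / 2) f g →
          ∫ x, f x ∂(HardyRellich.surf d) = 0 →
          ∃ m : ℝ,
            IsLeast
              (Set.range fun e : HardyRellich.Sph d =>
                ∫ x, (1 - inner ℝ (x : EuclideanSpace ℝ (Fin d))
                    (e : EuclideanSpace ℝ (Fin d))) * |g x| ^ 2 ∂(HardyRellich.surf d)) m ∧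
            ∫ x, |f x| ^ 2 ∂(HardyRellich.surf d) ≤ c d * m := by
  -- The argument gives the constant `8` in every dimension `d ≥ 4`.
  refine ⟨fun _ => 8, rfl, fun d hd => ⟨by norm_num, fun f g _ hfg hf => ?_⟩⟩
  have : Nontrivial (EuclideanSpace ℝ (Fin d)) :=
    Module.nontrivial_of_finrank_pos (R := ℝ) (by rw [finrank_euclideanSpace_fin]; omega)
  have : Nonempty (HardyRellich.Sph d) :=
    (NormedSpace.sphere_nonempty.2 zero_le_one).to_subtype
  obtain ⟨m, hm⟩ := (isCompact_range
    (HardyRellich.continuous_integral_one_sub_inner_mul g)).exists_isLeast (Set.range_nonempty _)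
  refine ⟨m, hm, ?_⟩
  obtain ⟨e, rfl⟩ := hm.1
  have he := EuclideanSpace.real_norm_sq_eq (e : EuclideanSpace ℝ (Fin d))
  rw [norm_eq_of_mem_sphere] at he
  rw [HardyRellich.integral_abs_sq]
  simp only [HardyRellich.integral_one_sub_inner_mul]
  exact HardyRellich.norm_sq_le hd (by simpa [← sq] using he.symm) hfg hf
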